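/- Let $G$ be a locally compact second countable Hausdorff topological group with its Borel $\sigma$-algebra, and let $\mathcal H_{\mathcal R}\neq 0$ and $\mathcal H_{\mathcal S}$ be separable complex Hilbert spaces carrying projective unitary representations $U_{\mathcal R},U_{\mathcal S}$ of $G$ for which $g\mapsto g.A:=U(g)AU(g)^*$ is strongly continuous for every bounded operator $A$ (in particular, ordinary strongly continuous unitary representations are allowed). Let $\mathcal R$ be a principal quantum reference frame, i.e. a normalized positive operator-valued measure $\mathsf E$ on $G$ with values in $B(\mathcal H_{\mathcal R})$ such that $\mathsf E(gX)=U_{\mathcal R}(g)\mathsf E(X)U_{\mathcal R}(g)^*$ for all $g\in G$ and all Borel sets $X\subseteq G$. Assume that $\mathcal R$ is localizable: for every Borel set $X$ with $\mathsf E(X)\neq 0$ and every $\epsilon>0$ there is a unit vector $\xi\in\mathcal H_{\mathcal R}$ with $\langle \xi,\mathsf E(X)\xi\rangle>1-\epsilon$. Let $¥^{\mathcal R}:B(\mathcal H_{\mathcal S})\to B(\mathcal H_{\mathcal R}\otimes\mathcal H_{\mathcal S})$, $¥^{\mathcal R}(A)=\int_G d\mathsf E(g)\otimes U_{\mathcal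 S}(g)AU_{\mathcal S}(g)^*$, be the relativization map, the integral being understood weakly: $$\langle x\otimes y,\,¥^{\mathcal R}(A)(x\otimes y)\rangle=\int_G\langle y,U_{\mathcal S}(g)AU_{\mathcal S}(g)^*y\rangle\,d\langle x,\mathsf E(g)x\rangle\qquad(x\in\mathcal H_{\mathcal R},\ y\in\mathcal H_{\mathcal S}).$$ Let $¥^{\mathcal R}_*$ be its predual, determined by $\mathrm{tr}[¥^{\mathcal R}_*(\Omega)A]=\mathrm{tr}[\Omega\,¥^{\mathcal R}(A)]$ for all $A\in B(\mathcal H_{\mathcal S})$. For a Hilbert space $\mathcal H$ write $\mathcal S(\mathcal H)$ for the set of its density operators (positive operators of trace one). Then the set of $\mathcal R$-relative states $¥^{\mathcal R}_*\big(\mathcal S(\mathcal H_{\mathcal R}\otimes\mathcal H_{\mathcal S})\big)$ is dense in $\mathcal S(\mathcal H_{\mathcal S})$ in the operational topology, i.e. the topology of pointwise convergence of the expectation values $\rho\mapsto\mathrm{tr}[\rho A]$, $A\in B(\mathcal H_{\mathcal S})$. Moreover, every $\rho\in\mathcal S(\mathcal H_{\mathcal S})$ is the limit in this topology of a sequence of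 $\mathcal R$-relative states. -/

import Mathlib

open MeasureTheory Filter Topology TensorProduct
open scoped InnerProductSpace Pointwise ENNReal

namespace QRF

section States

variable (H : Type*) [NormedAddCommGroup H] [InnerProductSpace ℂ H] [CompleteSpace H]

/-- The index set of a fixed orthonormal basis (complete orthonormal system) of `H`. -/
noncomputable def basisSet : Set H := (exists_hilbertBasis ℂ H).choose

/-- A fixed orthonormal basis of the Hilbert space `H`. -/
noncomputable def basis : HilbertBasis (basisSet H) ℂ H :=
  (exists_hilbertBasis ℂ H).choose_spec.choose

variable {H}

/-- The trace `∑ᵢ ⟨eᵢ, T eᵢ⟩` of an operator. It is only applied to positive operators and to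
products of a density operator with a bounded operator, where it does not depend on the basis. -/
noncomputable def trace (T : H →L[ℂ] H) : ℂ :=
  ∑' i, ⟪basis H i, T (basis H i)⟫_ℂ

variable (H)

/-- The states of a quantum system: density operators, i.e. positive operators of trace one.
(The value of a non-convergent sum is `0 ≠ 1`, so the trace condition contains convergence.) -/
structure State where
  op : H →L[ℂ] H
  isPositive : op.IsPositive
  trace_eq_one : trace op = 1

variable {H}

/-- The expectation value `tr[ρ A]`. -/
noncomputable def State.expect (ρ : State H) (A : H →L[ℂ] H) : ℂ := trace (ρ.op * A)

/-- The operational topology on states: the topology of pointwise convergence of the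
expectation values of all bounded operators. -/
noncomputable instance : TopologicalSpace (State H) :=
  TopologicalSpace.induced (fun (ρ : State H) (A : H →L[ℂ] H) => ρ.expect A) inferInstance

end States

section Representations

/-- A projective unitary representation of a topological group `G`, continuous in the sense that
the action `A ↦ U(g) A U(g)*` it induces on bounded operators is strongly continuous. Every
strongly continuous (projective or ordinary) unitary representation is of this kind. -/
structure ProjRep (G H : Type*) [Group G] [TopologicalSpace G]
    [NormedAddCommGroup H] [InnerProductSpace ℂ H] [CompleteSpace H] where
  toFun : G → unitary (H →L[ℂ] H)
  map_mul : ∀ g h : G, ∃ c : ℂ, ‖c‖ = 1 ∧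
    (toFun (g * h) : H →L[ℂ] H) = c • ((toFun g : H →L[ℂ] H) * (toFun h : H →L[ℂ] H))
  continuous_conj : ∀ (A : H →L[ℂ] H) (x : H), Continuous fun g : G =>
    ((toFun g : H →L[ℂ] H) * A * star (toFun g : H →L[ℂ] H)) x

variable {G H : Type*} [Group G] [TopologicalSpace G]
    [NormedAddCommGroup H] [InnerProductSpace ℂ H] [CompleteSpace H]

/-- The action `g.A = U(g) A U(g)*` on bounded operators. -/
noncomputable def ProjRep.act (U : ProjRep G H) (g : G) (A : H →L[ℂ] H) : H →L[ℂ] H :=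
  (U.toFun g : H →L[ℂ] H) * A * star (U.toFun g : H →L[ℂ] H)

end Representations

section POVM

/-- A (normalized) positive operator-valued measure. Only its values on measurable sets matter. -/
structure POVM (X H : Type*) [MeasurableSpace X]
    [NormedAddCommGroup H] [InnerProductSpace ℂ H] [CompleteSpace H] where
  toFun : Set X → (H →L[ℂ] H)
  isPositive : ∀ s, MeasurableSet s → (toFun s).IsPositive
  map_univ : toFun Set.univ = 1
  hasSum_iUnion : ∀ s : ℕ → Set X, (∀ i, MeasurableSet (s i)) →
    Pairwise (Function.onFun Disjoint s) → ∀ x : H,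
      HasSum (fun i => ⟪x, toFun (s i) x⟫_ℂ) ⟪x, toFun (⋃ i, s i) x⟫_ℂ

namespace POVM

variable {X H : Type*} [MeasurableSpace X]
    [NormedAddCommGroup H] [InnerProductSpace ℂ H] [CompleteSpace H]

/-- A POVM is localizable if every nonzero effect `E(s)` in its range takes expectation values
arbitrarily close to one in pure states. -/
def Localizable (E : POVM X H) : Prop :=
  ∀ s, MeasurableSet s → E.toFun s ≠ 0 → ∀ ε : ℝ, 0 < ε →
    ∃ ξ : H, ‖ξ‖ = 1 ∧ 1 - ε < (⟪ξ, E.toFun s ξ⟫_ℂ).re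

theorem inner_eq_ofReal (E : POVM X H) {s : Set X} (hs : MeasurableSet s) (x : H) :
    ⟪x, E.toFun s x⟫_ℂ = ((⟪x, E.toFun s x⟫_ℂ).re : ℂ) := by
  have h := (E.isPositive s hs).inner_nonneg_right x
  rw [Complex.le_def] at h
  apply Complex.ext <;> simp [← h.2]

theorem re_inner_nonneg (E : POVM X H) {s : Set X} (hs : MeasurableSet s) (x : H) :
    0 ≤ (⟪x, E.toFun s x⟫_ℂ).re := by
  have h := (E.isPositive s hs).inner_nonneg_right x
  rw [Complex.le_def] at h
  exact h.1

theorem inner_empty (E : POVM X H) (x : H) : ⟪x, E.toFun ∅ x⟫_ℂ = 0 := by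
  have h := E.hasSum_iUnion (fun _ => ∅) (fun _ => MeasurableSet.empty)
    (fun i j _ => by simp [Function.onFun]) x
  have h0 := h.summable.tendsto_atTop_zero
  exact tendsto_nhds_unique tendsto_const_nhds h0

/-- The measure `s ↦ ⟨x, E(s) x⟩` determined by a POVM and a vector. -/
noncomputable def measure (E : POVM X H) (x : H) : Measure X :=
  Measure.ofMeasurable (fun s _ => ENNReal.ofReal (⟪x, E.toFun s x⟫_ℂ).re)
    (by simp [E.inner_empty x])
    (by
      intro s hs hd
      have h := (Complex.hasSum_iff _ _).1 (E.hasSum_iUnion s hs hd x)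
      rw [← h.1.tsum_eq]
      exact ENNReal.ofReal_tsum_of_nonneg (fun i => E.re_inner_nonneg (hs i) x) h.1.summable)

theorem measure_apply (E : POVM X H) (x : H) {s : Set X} (hs : MeasurableSet s) :
    E.measure x s = ENNReal.ofReal (⟪x, E.toFun s x⟫_ℂ).re :=
  Measure.ofMeasurable_apply s hs

instance (E : POVM X H) (x : H) : IsFiniteMeasure (E.measure x) :=
  ⟨by rw [E.measure_apply x MeasurableSet.univ]; exact ENNReal.ofReal_lt_top⟩

theorem inner_eq_measure (E : POVM X H) {s : Set X} (hs : MeasurableSet s) (x : H) :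
    ⟪x, E.toFun s x⟫_ℂ = (((E.measure x).real s : ℝ) : ℂ) := by
  rw [E.inner_eq_ofReal hs, Measure.real, E.measure_apply x hs,
    ENNReal.toReal_ofReal (E.re_inner_nonneg hs x)]

theorem sum_eq_integral (E : POVM X H) (τ : SimpleFunc X X) (f : X → ℂ) (x : H) :
    ∑ h ∈ τ.range, ⟪x, E.toFun (τ ⁻¹' {h}) x⟫_ℂ * f h = ∫ g, f (τ g) ∂(E.measure x) := by
  have h1 : ∀ g, f (τ g) = ∑ h ∈ τ.range, (τ ⁻¹' {h}).indicator (fun _ => f h) g := by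
    intro g
    rw [Finset.sum_eq_single_of_mem (τ g) (τ.mem_range_self g)]
    · simp
    · intro h _ hne
      exact Set.indicator_of_notMem (by simpa using hne.symm) _
  simp_rw [h1]
  rw [integral_finsetSum]
  · refine Finset.sum_congr rfl fun h _ => ?_
    rw [integral_indicator_const _ (τ.measurableSet_preimage _),
      E.inner_eq_measure (τ.measurableSet_preimage _), Complex.real_smul]
  · exact fun h _ => (integrable_const _).indicator (τ.measurableSet_preimage _)

theorem sum_preimage (E : POVM X H) (τ : SimpleFunc X X) :
    ∑ h ∈ τ.range, E.toFun (τ ⁻¹' {h}) = 1 := by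
  refine ContinuousLinearMap.coe_inj.1 ((ext_inner_map _ _).1 fun x => ?_)
  rw [← inner_conj_symm, ← inner_conj_symm ((1 : H →L[ℂ] H).toLinearMap x)]
  congr 1
  have h1 := E.sum_eq_integral τ (fun _ => 1) x
  have h2 := E.inner_eq_measure MeasurableSet.univ x
  simp only [mul_one, integral_const, Complex.real_smul] at h1
  rw [← h2, E.map_univ] at h1
  simpa [sum_apply, inner_sum] using h1

end POVM

end POVM

/-- A principal quantum reference frame: a covariant POVM whose sample space is the group `G`,
acting on itself by left translations. -/
structure PrincipalFrame (G H : Type*) [Group G] [TopologicalSpace G] [MeasurableSpace G]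
    [NormedAddCommGroup H] [InnerProductSpace ℂ H] [CompleteSpace H] where
  rep : ProjRep G H
  povm : POVM G H
  covariant : ∀ (g : G) (s : Set G), MeasurableSet s →
    povm.toFun (g • s) = rep.act g (povm.toFun s)

section Composite

variable (H K : Type*) [NormedAddCommGroup H] [InnerProductSpace ℂ H]
  [NormedAddCommGroup K] [InnerProductSpace ℂ K]

/-- The Hilbert space tensor product: the completion of the algebraic tensor product. -/
abbrev HTensor : Type _ := UniformSpace.Completion (H ⊗[ℂ] K)

variable {H K}

/-- The product vector `x ⊗ y` in the Hilbert space tensor product. -/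
noncomputable def htmul (x : H) (y : K) : HTensor H K := ((x ⊗ₜ[ℂ] y : H ⊗[ℂ] K) : HTensor H K)

end Composite

section WeakLimit

variable {K : Type*} [NormedAddCommGroup K] [InnerProductSpace ℂ K] [CompleteSpace K]

theorem exists_weak_limit (S : ℕ → K →L[ℂ] K) (M : ℝ)
    (hS : ∀ n x y, ‖⟪S n x, y⟫_ℂ‖ ≤ M * ‖x‖ * ‖y‖) :
    ∃ T : K →L[ℂ] K, ∀ x y l, Tendsto (fun n => ⟪S n x, y⟫_ℂ) atTop (𝓝 l) →
      ⟪T x, y⟫_ℂ = l := by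
  have key : ∀ x y, ∃ l : ℂ, ‖l‖ ≤ M * ‖x‖ * ‖y‖ ∧
      Tendsto (fun n => ⟪S n x, y⟫_ℂ) (hyperfilter ℕ) (𝓝 l) := by
    intro x y
    obtain ⟨l, hl, h⟩ := (isCompact_closedBall (0 : ℂ) (M * ‖x‖ * ‖y‖)).ultrafilter_le_nhds
      ((hyperfilter ℕ).map (fun n => ⟪S n x, y⟫_ℂ)) (by
        rw [le_principal_iff]
        exact Filter.mem_map.2 (Filter.univ_mem' fun n => by simpa using hS n x y))
    exact ⟨l, by simpa using hl, h⟩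
  choose L hL hlim using key
  let B : K →L⋆[ℂ] K →L[ℂ] ℂ := LinearMap.mkContinuous₂
    (LinearMap.mk₂'ₛₗ (starRingEnd ℂ) (RingHom.id ℂ) L
      (fun x x' y => tendsto_nhds_unique (hlim _ _)
        (by simpa [inner_add_left] using (hlim x y).add (hlim x' y)))
      (fun c x y => tendsto_nhds_unique (hlim _ _)
        (by simpa [inner_smul_left, mul_comm] using (hlim x y).const_mul ((starRingEnd ℂ) c)))
      (fun x y y' => tendsto_nhds_unique (hlim _ _)
        (by simpa [inner_add_right] using (hlim x y).add (hlim x y')))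
      (fun c x y => tendsto_nhds_unique (hlim _ _)
        (by simpa [inner_smul_right] using (hlim x y).const_mul c)))
    M (fun x y => hL x y)
  refine ⟨InnerProductSpace.continuousLinearMapOfBilin B, fun x y l h => ?_⟩
  rw [InnerProductSpace.continuousLinearMapOfBilin_apply]
  refine tendsto_nhds_unique (hlim x y) (h.mono_left ?_)
  exact Nat.hyperfilter_le_atTop

end WeakLimit

section Relativization

variable {H K : Type*} [NormedAddCommGroup H] [InnerProductSpace ℂ H] [CompleteSpace H]
  [NormedAddCommGroup K] [InnerProductSpace ℂ K]

theorem inner_mapL_mul_self (D : H →L[ℂ] H) (hD : star D = D) (B : K →L[ℂ] K)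
    (x y : H ⊗[ℂ] K) :
    ⟪mapL (D * D) B x, y⟫_ℂ = ⟪B.lTensor H (D.rTensor K x), D.rTensor K y⟫_ℂ := by
  induction x using TensorProduct.induction_on with
  | zero => simp
  | add x x' hx hx' => simp only [map_add, inner_add_left, hx, hx']
  | tmul a b =>
    induction y using TensorProduct.induction_on with
    | zero => simp
    | add y y' hy hy' => simp only [map_add, inner_add_right, hy, hy']
    | tmul c d =>
      simp only [mapL_tmul, ContinuousLinearMap.rTensor_tmul, ContinuousLinearMap.lTensor_tmul,
        TensorProduct.inner_tmul]
      congr 1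
      rw [ContinuousLinearMap.star_eq_adjoint] at hD
      have h := ContinuousLinearMap.adjoint_inner_left D c (D a)
      rw [hD] at h
      exact h

theorem norm_inner_sum_mapL_le {ι : Type*} (s : Finset ι) (F : ι → H →L[ℂ] H)
    (hF : ∀ i ∈ s, (F i).IsPositive) (hF1 : ∑ i ∈ s, F i = 1) (B : ι → K →L[ℂ] K) (M : ℝ)
    (hB : ∀ i ∈ s, ‖B i‖ ≤ M) (hM : 0 ≤ M) (x y : H ⊗[ℂ] K) :
    ‖⟪(∑ i ∈ s, mapL (F i) (B i) : H ⊗[ℂ] K →L[ℂ] H ⊗[ℂ] K) x, y⟫_ℂ‖ ≤ M * ‖x‖ * ‖y‖ := by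
  classical
  have hD : ∀ i ∈ s, ∃ D : H →L[ℂ] H, star D = D ∧ D * D = F i := by
    intro i hi
    have h0 : 0 ≤ F i := (ContinuousLinearMap.nonneg_iff_isPositive _).2 (hF i hi)
    exact ⟨CFC.sqrt (F i), (IsSelfAdjoint.of_nonneg (CFC.sqrt_nonneg _)).star_eq,
      CFC.sqrt_mul_sqrt_self _ h0⟩
  choose! D hDs hDm using hD
  have hsum : ∀ z : H ⊗[ℂ] K, ∑ i ∈ s, ‖(D i).rTensor K z‖ ^ 2 = ‖z‖ ^ 2 := by
    intro z
    have h1 : ∀ i ∈ s, ((‖(D i).rTensor K z‖ ^ 2 : ℝ) : ℂ)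
        = ⟪mapL (F i) (1 : K →L[ℂ] K) z, z⟫_ℂ := by
      intro i hi
      rw [← hDm i hi, inner_mapL_mul_self _ (hDs i hi), ContinuousLinearMap.lTensor_one,
        one_apply_eq_self, inner_self_eq_norm_sq_to_K]
      norm_cast
    have h2 : (∑ i ∈ s, mapL (F i) (1 : K →L[ℂ] K)) = 1 := by
      have : (∑ i ∈ s, (F i).rTensor K) = 1 := by
        rw [← ContinuousLinearMap.rTensor_one, ← hF1]
        ext z
        simp only [sum_apply]
        induction z using TensorProduct.induction_on with
        | zero => simp
        | add x x' hx hx' => simp only [map_add, Finset.sum_add_distrib, hx, hx']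
        | tmul a b => simp [TensorProduct.sum_tmul]
      rw [← this]
      refine Finset.sum_congr rfl fun i _ => ?_
      rw [ContinuousLinearMap.rTensor_eq_mapL]
      rfl
    have h3 : ((∑ i ∈ s, ‖(D i).rTensor K z‖ ^ 2 : ℝ) : ℂ) = ((‖z‖ ^ 2 : ℝ) : ℂ) := by
      rw [Complex.ofReal_sum, Finset.sum_congr rfl h1, ← sum_inner,
        ← sum_apply, h2, one_apply_eq_self,
        inner_self_eq_norm_sq_to_K]
      norm_cast
    exact_mod_cast h3
  rw [sum_apply, sum_inner]
  calc ‖∑ i ∈ s, ⟪mapL (F i) (B i) x, y⟫_ℂ‖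
      ≤ ∑ i ∈ s, M * (‖(D i).rTensor K x‖ * ‖(D i).rTensor K y‖) := by
        refine norm_sum_le_of_le _ fun i hi => ?_
        rw [← hDm i hi, inner_mapL_mul_self _ (hDs i hi)]
        refine (norm_inner_le_norm _ _).trans ?_
        rw [← mul_assoc]
        gcongr
        refine ((B i).lTensor H).le_opNorm _ |>.trans ?_
        gcongr
        exact (ContinuousLinearMap.norm_lTensor_le _ (B i)).trans (hB i hi)
    _ ≤ M * (‖x‖ * ‖y‖) := by
        rw [← Finset.mul_sum]
        gcongr
        refine (Real.sum_mul_le_sqrt_mul_sqrt s _ _).trans ?_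
        rw [hsum, hsum, Real.sqrt_sq (norm_nonneg _), Real.sqrt_sq (norm_nonneg _)]
    _ = M * ‖x‖ * ‖y‖ := by ring

variable [CompleteSpace K] {G : Type*} [Group G] [TopologicalSpace G]

theorem ProjRep.norm_act_le (U : ProjRep G K) (g : G) (A : K →L[ℂ] K) : ‖U.act g A‖ ≤ ‖A‖ := by
  have h : ‖U.act g A‖ = ‖A‖ := by
    rw [ProjRep.act, mul_assoc, CStarRing.norm_coe_unitary_mul, ← Unitary.coe_star,
      CStarRing.norm_mul_coe_unitary]
  exact h.le

variable [MeasurableSpace G]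

theorem htmul_ext {T T' : HTensor H K →L[ℂ] HTensor H K}
    (h : ∀ x y, ⟪htmul x y, T (htmul x y)⟫_ℂ = ⟪htmul x y, T' (htmul x y)⟫_ℂ) : T = T' := by
  let D := T - T'
  have hD : ∀ x y, ⟪htmul x y, D (htmul x y)⟫_ℂ = 0 := fun x y => by
    simp [D, inner_sub_right, h]
  let J : H →L[ℂ] K →L[ℂ] HTensor H K :=
    (ContinuousLinearMap.compL ℂ K (H ⊗[ℂ] K) (HTensor H K)
      UniformSpace.Completion.toComplL).comp (mkL ℂ H K)
  have hJ : ∀ x y, J x y = htmul x y := fun x y => rfl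
  have h1 : ∀ x x' y, ⟪htmul x y, D (htmul x' y)⟫_ℂ = 0 := by
    intro x x' y
    let P : H →L[ℂ] HTensor H K := J.flip y
    have hP : (P.adjoint ∘L D ∘L P : H →L[ℂ] H).toLinearMap = 0 := by
      rw [← inner_map_self_eq_zero]
      intro z
      have := hD z y
      rw [← inner_conj_symm, map_eq_zero]
      simpa [ContinuousLinearMap.adjoint_inner_right, P, hJ] using this
    have := congrArg (fun L : H →ₗ[ℂ] H => ⟪x, L x'⟫_ℂ) hP
    simpa [ContinuousLinearMap.adjoint_inner_right, P, hJ] using this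
  have h2 : ∀ x x' y y', ⟪htmul x y, D (htmul x' y')⟫_ℂ = 0 := by
    intro x x' y y'
    have hP : ((J x).adjoint ∘L D ∘L (J x') : K →L[ℂ] K).toLinearMap = 0 := by
      rw [← inner_map_self_eq_zero]
      intro z
      have := h1 x x' z
      rw [← inner_conj_symm, map_eq_zero]
      simpa [ContinuousLinearMap.adjoint_inner_right, hJ] using this
    have := congrArg (fun L : K →ₗ[ℂ] K => ⟪y, L y'⟫_ℂ) hP
    simpa [ContinuousLinearMap.adjoint_inner_right, hJ] using this
  have h3 : ∀ u v : HTensor H K, ⟪u, D v⟫_ℂ = 0 := by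
    intro u v
    refine UniformSpace.Completion.induction_on₂ u v
      (isClosed_eq (by fun_prop) continuous_const) fun a b => ?_
    induction a using TensorProduct.induction_on with
    | zero => rw [UniformSpace.Completion.coe_zero, inner_zero_left]
    | add a a' ha ha' => rw [UniformSpace.Completion.coe_add, inner_add_left, ha, ha', add_zero]
    | tmul x y =>
      induction b using TensorProduct.induction_on with
      | zero => rw [UniformSpace.Completion.coe_zero, map_zero, inner_zero_right]
      | add b b' hb hb' =>
        rw [UniformSpace.Completion.coe_add, map_add, inner_add_right, hb, hb', add_zero]
      | tmul x' y' => exact h2 x x' y y'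
  have h4 : D = 0 := by
    ext v
    exact inner_self_eq_zero.1 (h3 _ v)
  exact sub_eq_zero.1 h4

theorem exists_relativization [IsTopologicalGroup G] [SecondCountableTopology G] [T2Space G]
    [BorelSpace G] (E : POVM G H) (U : ProjRep G K) (A : K →L[ℂ] K) :
    ∃ T : HTensor H K →L[ℂ] HTensor H K, ∀ x y,
      ⟪htmul x y, T (htmul x y)⟫_ℂ = ∫ g, ⟪y, U.act g A y⟫_ℂ ∂(E.measure x) := by
  have hid : StronglyMeasurable (id : G → G) := measurable_id.stronglyMeasurable
  let τ : ℕ → SimpleFunc G G := hid.approx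
  let S₀ : ℕ → (H ⊗[ℂ] K) →L[ℂ] (H ⊗[ℂ] K) := fun n =>
    ∑ h ∈ (τ n).range, mapL (E.toFun (τ n ⁻¹' {h})) (U.act h A)
  have hS₀ : ∀ n x y, ‖⟪S₀ n x, y⟫_ℂ‖ ≤ ‖A‖ * ‖x‖ * ‖y‖ := fun n x y =>
    norm_inner_sum_mapL_le _ _ (fun h _ => E.isPositive _ ((τ n).measurableSet_preimage _))
      (E.sum_preimage (τ n)) _ _ (fun h _ => U.norm_act_le h A) (norm_nonneg _) x y
  let S : ℕ → HTensor H K →L[ℂ] HTensor H K := fun n => (S₀ n).completion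
  have hS : ∀ n x y, ‖⟪S n x, y⟫_ℂ‖ ≤ ‖A‖ * ‖x‖ * ‖y‖ := by
    intro n x y
    refine UniformSpace.Completion.induction_on₂ x y
      (isClosed_le (by fun_prop) (by fun_prop)) fun a b => ?_
    simpa [S] using hS₀ n a b
  obtain ⟨T, hT⟩ := exists_weak_limit S _ hS
  refine ⟨T, fun x y => ?_⟩
  have hlim : Tendsto (fun n => ∫ g, ⟪y, U.act (τ n g) A y⟫_ℂ ∂(E.measure x)) atTop
      (𝓝 (∫ g, ⟪y, U.act g A y⟫_ℂ ∂(E.measure x))) := by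
    have hc : Continuous fun g => ⟪y, U.act g A y⟫_ℂ :=
      continuous_const.inner (U.continuous_conj A y)
    refine tendsto_integral_of_dominated_convergence (fun _ => ‖y‖ * (‖A‖ * ‖y‖))
      (fun n => ?_) (integrable_const _) (fun n => ?_) ?_
    · exact (hc.measurable.comp (τ n).measurable).aestronglyMeasurable
    · refine ae_of_all _ fun g => (norm_inner_le_norm _ _).trans ?_
      gcongr
      exact ((U.act (τ n g) A).le_opNorm y).trans (by gcongr; exact U.norm_act_le _ A)
    · exact ae_of_all _ fun g => (hc.tendsto g).comp (hid.tendsto_approx g)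
  have hterm : ∀ n, ⟪S n (htmul x y), htmul x y⟫_ℂ
      = (starRingEnd ℂ) (∫ g, ⟪y, U.act (τ n g) A y⟫_ℂ ∂(E.measure x)) := by
    intro n
    rw [← E.sum_eq_integral (τ n) (fun g => ⟪y, U.act g A y⟫_ℂ) x]
    simp [S, S₀, htmul, sum_inner, sum_apply]
  have h := hT (htmul x y) (htmul x y) _ (by
    simp only [hterm]
    exact (Complex.continuous_conj.tendsto _).comp hlim)
  rw [← inner_conj_symm, h, Complex.conj_conj]

theorem existsUnique_relativization [IsTopologicalGroup G] [SecondCountableTopology G] [T2Space G]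
    [BorelSpace G] (E : POVM G H) (U : ProjRep G K) (A : K →L[ℂ] K) :
    ∃! T : HTensor H K →L[ℂ] HTensor H K, ∀ x y,
      ⟪htmul x y, T (htmul x y)⟫_ℂ = ∫ g, ⟪y, U.act g A y⟫_ℂ ∂(E.measure x) := by
  obtain ⟨T, hT⟩ := exists_relativization E U A
  exact ⟨T, hT, fun T' hT' => htmul_ext fun x y => (hT' x y).trans (hT x y).symm⟩

namespace PrincipalFrame

variable [IsTopologicalGroup G] [SecondCountableTopology G] [T2Space G] [BorelSpace G]

/-- The relativization map `¥(A) = ∫_G dE(g) ⊗ g.A`, as a weak operator integral: `¥(A)` is the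
unique bounded operator with `⟨x ⊗ y, ¥(A) (x ⊗ y)⟩ = ∫_G ⟨y, (g.A) y⟩ d⟨x, E(g) x⟩` for all
`x` and `y` (product vectors suffice, by polarization and density). -/
noncomputable def yen (R : PrincipalFrame G H) (U : ProjRep G K) (A : K →L[ℂ] K) :
    HTensor H K →L[ℂ] HTensor H K :=
  (existsUnique_relativization R.povm U A).choose

theorem inner_yen (R : PrincipalFrame G H) (U : ProjRep G K) (A : K →L[ℂ] K) (x : H) (y : K) :
    ⟪htmul x y, R.yen U A (htmul x y)⟫_ℂ = ∫ g, ⟪y, U.act g A y⟫_ℂ ∂(R.povm.measure x) :=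
  (existsUnique_relativization R.povm U A).choose_spec.1 x y

/-- `ρ = ¥_*(Ω)`, where `¥_*` is the predual of `¥`: `tr[¥_*(Ω) A] = tr[Ω ¥(A)]` for all bounded
operators `A` of the system. -/
def IsYenPredual (R : PrincipalFrame G H) (U : ProjRep G K) (Ω : State (HTensor H K))
    (ρ : State K) : Prop :=
  ∀ A : K →L[ℂ] K, ρ.expect A = Ω.expect (R.yen U A)

/-- The relative states, realized inside the state space of the system: the image `¥_*(S(H ⊗ K))`
of the states of the composite system. -/
def relativeStates (R : PrincipalFrame G H) (U : ProjRep G K) : Set (State K) :=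
  {ρ | ∃ Ω : State (HTensor H K), R.IsYenPredual U Ω ρ}

end PrincipalFrame

end Relativization

end QRF

/-! Prepare the frame in a unit vector `ξ` and the system in `ρ`. Evaluating `¥(A)` in the product
state `|ξ⟩⟨ξ| ⊗ ρ` gives `∫ tr[ρ (g.A)] dμ_ξ(g)` with the probability measure `μ_ξ = ⟨ξ, E(·) ξ⟩`,
so the average of `ρ` against `μ_ξ` is a relative state (`exists_mem_relativeStates`). The integrand
is continuous, bounded by `‖A‖`, and equals `tr[ρ A]` at `g = 1`. If the measures `μ_{ξ_n}`
concentrate at the identity, the averages therefore converge to `ρ` on every `A`.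

Such `ξ_n` exist (`exists_localizing_sequence`). By covariance, an open neighbourhood of `1` with
zero effect would have only null translates, and countably many of them cover `G`, against `E(G) =
1`. Localizability therefore applies along a countable neighbourhood basis of `1`, which is why
sequences suffice.

The analytic work is to see that the average is a density operator and not merely a positive
functional. States are handled as functionals `A ↦ ∑ ⟨wᵢ, A wᵢ⟩` with `∑ ‖wᵢ‖² = 1`. A normalized
positive functional comes from a density operator once it is additive along `A = ∑ |A bⱼ⟩⟨bⱼ|`
(`exists_state_of_normal`), and this additivity survives averaging by dominated exchange of sum and
integral. -/

namespace QRF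

open scoped ComplexOrder
open InnerProductSpace (rankOne rankOne_apply)

/-! ### Vector families and normality of their functionals -/

section Hilbert

variable {ι J H : Type*} [NormedAddCommGroup H] [InnerProductSpace ℂ H]

theorem _root_.Orthonormal.sum_norm_inner_mul_inner_le {e : J → H} (he : Orthonormal ℂ e)
    (s : Finset J) (x y : H) : ∑ j ∈ s, ‖⟪x, e j⟫_ℂ * ⟪e j, y⟫_ℂ‖ ≤ ‖x‖ * ‖y‖ := by
  simp_rw [norm_mul, norm_inner_symm x]
  refine (Real.sum_mul_le_sqrt_mul_sqrt s _ _).trans ?_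
  gcongr <;> exact Real.sqrt_le_iff.2 ⟨norm_nonneg _, he.sum_inner_products_le _⟩

/-- Distinct vectors are `√2` apart, so their balls of radius `1/2` are disjoint nonempty open sets,
of which a separable space has only countably many. -/
theorem _root_.Orthonormal.countable [TopologicalSpace.SeparableSpace H] {e : J → H}
    (he : Orthonormal ℂ e) : Countable J := by
  have hd : Pairwise (Function.onFun Disjoint fun j => Metric.ball (e j) (1 / 2)) := by
    intro i j hij
    refine Metric.ball_disjoint_ball ?_
    have h : ‖e i - e j‖ ^ 2 = 2 := by
      rw [@norm_sub_sq ℂ, he.2 hij, he.1, he.1]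
      norm_num
    rw [dist_eq_norm]
    nlinarith [norm_nonneg (e i - e j)]
  exact hd.countable_of_isOpen_disjoint (fun _ => Metric.isOpen_ball)
    fun j => ⟨e j, Metric.mem_ball_self (by norm_num)⟩

/-- The functional `A ↦ ∑ᵢ ⟨wᵢ, A wᵢ⟩` determined by a family of vectors. -/
noncomputable def vecExpect (w : ι → H) (A : H →L[ℂ] H) : ℂ := ∑' i, ⟪w i, A (w i)⟫_ℂ

theorem norm_inner_apply_self_le (A : H →L[ℂ] H) (x : H) : ‖⟪x, A x⟫_ℂ‖ ≤ ‖A‖ * ‖x‖ ^ 2 := by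
  refine (norm_inner_le_norm _ _).trans ?_
  calc ‖x‖ * ‖A x‖ ≤ ‖x‖ * (‖A‖ * ‖x‖) := by gcongr; exact A.le_opNorm x
    _ = ‖A‖ * ‖x‖ ^ 2 := by ring

variable {w : ι → H} {c : ℝ}

theorem summable_norm_inner_apply_self (hw : HasSum (fun i => ‖w i‖ ^ 2) c) (A : H →L[ℂ] H) :
    Summable fun i => ‖⟪w i, A (w i)⟫_ℂ‖ :=
  .of_nonneg_of_le (fun _ => norm_nonneg _) (fun _ => norm_inner_apply_self_le A _)
    (hw.summable.mul_left _)

theorem norm_vecExpect_le (hw : HasSum (fun i => ‖w i‖ ^ 2) c) (A : H →L[ℂ] H) :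
    ‖vecExpect w A‖ ≤ ‖A‖ * c :=
  tsum_of_norm_bounded (hw.mul_left _) fun _ => norm_inner_apply_self_le A _

theorem vecExpect_add (hw : HasSum (fun i => ‖w i‖ ^ 2) c) (A B : H →L[ℂ] H) :
    vecExpect w (A + B) = vecExpect w A + vecExpect w B := by
  simp only [vecExpect, add_apply, inner_add_right]
  exact (summable_norm_inner_apply_self hw A).of_norm.tsum_add
    (summable_norm_inner_apply_self hw B).of_norm

theorem vecExpect_smul (a : ℂ) (A : H →L[ℂ] H) :
    vecExpect w (a • A) = a * vecExpect w A := by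
  simp only [vecExpect, smul_apply, inner_smul_right, tsum_mul_left]

theorem vecExpect_one (hw : HasSum (fun i => ‖w i‖ ^ 2) c) : vecExpect w 1 = c := by
  simp only [vecExpect, one_apply_eq_self, inner_self_eq_norm_sq_to_K]
  simpa using (Complex.hasSum_ofReal.2 hw).tsum_eq

theorem vecExpect_rankOne_self_nonneg (x : H) : 0 ≤ vecExpect w (rankOne ℂ x x) := by
  refine tsum_nonneg fun i => ?_
  rw [rankOne_apply, inner_smul_right, ← inner_conj_symm, mul_comm]
  simpa using mul_star_self_nonneg ⟪w i, x⟫_ℂ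

theorem inner_rankOne_apply_self [CompleteSpace H] (A : H →L[ℂ] H) (x y : H) :
    ⟪x, rankOne ℂ (A y) y x⟫_ℂ = ⟪A.adjoint x, y⟫_ℂ * ⟪y, x⟫_ℂ := by
  rw [rankOne_apply, inner_smul_right, ContinuousLinearMap.adjoint_inner_left, mul_comm]

/-- Cauchy–Schwarz and Bessel bound the part of each `w i` by `‖A‖ ‖w i‖²`. The total depends on `w`
only through `c`, hence is uniform along a group orbit and can dominate the sum under the integral
over `G`. -/
theorem sum_norm_vecExpect_rankOne_le [CompleteSpace H] {e : J → H} (he : Orthonormal ℂ e)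
    (hw : HasSum (fun i => ‖w i‖ ^ 2) c) (A : H →L[ℂ] H) (s : Finset J) :
    ∑ j ∈ s, ‖vecExpect w (rankOne ℂ (A (e j)) (e j))‖ ≤ ‖A‖ * c := by
  have hs := fun j => summable_norm_inner_apply_self hw (rankOne ℂ (A (e j)) (e j))
  calc ∑ j ∈ s, ‖vecExpect w (rankOne ℂ (A (e j)) (e j))‖
      ≤ ∑ j ∈ s, ∑' i, ‖⟪w i, rankOne ℂ (A (e j)) (e j) (w i)⟫_ℂ‖ :=
        Finset.sum_le_sum fun j _ => norm_tsum_le_tsum_norm (hs j)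
    _ = ∑' i, ∑ j ∈ s, ‖⟪w i, rankOne ℂ (A (e j)) (e j) (w i)⟫_ℂ‖ :=
        (Summable.tsum_finsetSum fun j _ => hs j).symm
    _ ≤ ∑' i, ‖A‖ * ‖w i‖ ^ 2 := by
        refine Summable.tsum_le_tsum (fun i => ?_) (summable_sum fun j _ => hs j)
          (hw.summable.mul_left _)
        simp_rw [inner_rankOne_apply_self]
        refine (he.sum_norm_inner_mul_inner_le s _ _).trans ?_
        rw [pow_two, ← mul_assoc]
        gcongr
        exact (A.adjoint.le_opNorm _).trans_eq (by rw [LinearIsometryEquiv.norm_map])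
    _ = ‖A‖ * c := (hw.mul_left _).tsum_eq

/-- Normality: Parseval expands each `⟨A* wᵢ, wᵢ⟩` along `b`, and Bessel makes the double series
absolutely summable, so its order may be exchanged. -/
theorem hasSum_vecExpect_rankOne [CompleteSpace H] (b : HilbertBasis J ℂ H)
    (hw : HasSum (fun i => ‖w i‖ ^ 2) c) (A : H →L[ℂ] H) :
    HasSum (fun j => vecExpect w (rankOne ℂ (A (b j)) (b j))) (vecExpect w A) := by
  have hrow := fun i => b.hasSum_inner_mul_inner (A.adjoint (w i)) (w i)
  have hbound : ∀ i, ∀ s : Finset J,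
      ∑ j ∈ s, ‖⟪A.adjoint (w i), b j⟫_ℂ * ⟪b j, w i⟫_ℂ‖ ≤ ‖A‖ * ‖w i‖ ^ 2 := by
    intro i s
    refine (b.orthonormal.sum_norm_inner_mul_inner_le s _ _).trans ?_
    rw [pow_two, ← mul_assoc]
    gcongr
    exact (A.adjoint.le_opNorm _).trans_eq (by rw [LinearIsometryEquiv.norm_map])
  have hsum : Summable (Function.uncurry fun i j => ⟪A.adjoint (w i), b j⟫_ℂ * ⟪b j, w i⟫_ℂ) := by
    refine Summable.of_norm ((summable_prod_of_nonneg fun _ => norm_nonneg _).2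
      ⟨fun i => (hrow i).summable.norm, ?_⟩)
    exact .of_nonneg_of_le (fun i => tsum_nonneg fun j => norm_nonneg _)
      (fun i => (hrow i).summable.norm.tsum_le_of_sum_le (hbound i)) (hw.summable.mul_left ‖A‖)
  have h0 : Summable fun p : J × ι => ⟪A.adjoint (w p.2), b p.1⟫_ℂ * ⟪b p.1, w p.2⟫_ℂ :=
    hsum.prod_symm
  have h1 := h0.prod.hasSum
  have h2 : ∑' j, ∑' i, ⟪A.adjoint (w i), b j⟫_ℂ * ⟪b j, w i⟫_ℂ =
      ∑' i, ∑' j, ⟪A.adjoint (w i), b j⟫_ℂ * ⟪b j, w i⟫_ℂ := Summable.tsum_comm hsum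
  have h3 : ∑' i, ∑' j, ⟪A.adjoint (w i), b j⟫_ℂ * ⟪b j, w i⟫_ℂ = vecExpect w A :=
    tsum_congr fun i => by rw [(hrow i).tsum_eq, ContinuousLinearMap.adjoint_inner_left]
  rw [h2, h3] at h1
  have h4 : (fun j => vecExpect w (rankOne ℂ (A (b j)) (b j))) =
      fun j => ∑' i, ⟪A.adjoint (w i), b j⟫_ℂ * ⟪b j, w i⟫_ℂ :=
    funext fun j => tsum_congr fun i => inner_rankOne_apply_self A (w i) (b j)
  rw [h4]
  exact h1

end Hilbert

/-! ### Density operators and normal functionals -/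

section State

variable {H : Type*} [NormedAddCommGroup H] [InnerProductSpace ℂ H] [CompleteSpace H]

/-- Take `vᵢ = √ρ eᵢ`. Expanded along the basis, `tr[ρ A]` and `∑ ⟨vᵢ, A vᵢ⟩` become the same double
series. -/
theorem State.exists_vecExpect (ρ : State H) :
    ∃ v : basisSet H → H, HasSum (fun i => ‖v i‖ ^ 2) 1 ∧
      ∀ A : H →L[ℂ] H, ρ.expect A = vecExpect v A := by
  have h0 : 0 ≤ ρ.op := (ContinuousLinearMap.nonneg_iff_isPositive _).2 ρ.isPositive
  let D := CFC.sqrt ρ.op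
  have hDD : D * D = ρ.op := CFC.sqrt_mul_sqrt_self _ h0
  have hDs : D.adjoint = D := (IsSelfAdjoint.of_nonneg (CFC.sqrt_nonneg _)).star_eq
  have hD : ∀ x y, ⟪D x, y⟫_ℂ = ⟪x, D y⟫_ℂ := fun x y => by
    conv_lhs => rw [← hDs, ContinuousLinearMap.adjoint_inner_left]
  have hρ : ∀ x, ρ.op x = D (D x) := fun x => by rw [← hDD]; rfl
  have hv : HasSum (fun i => ‖D (basis H i)‖ ^ 2) 1 := by
    have h1 : ∀ i, ⟪basis H i, ρ.op (basis H i)⟫_ℂ = ((‖D (basis H i)‖ ^ 2 : ℝ) : ℂ) := by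
      intro i
      rw [hρ, ← hD, inner_self_eq_norm_sq_to_K]
      norm_cast
    have h2 := ρ.trace_eq_one
    simp only [trace, h1] at h2
    -- A divergent sum would have the default value `0`, contradicting trace one.
    have hs : Summable fun i => ((‖D (basis H i)‖ ^ 2 : ℝ) : ℂ) := by
      by_contra h
      rw [tsum_eq_zero_of_not_summable h] at h2
      exact zero_ne_one h2
    have h3 := hs.hasSum
    rw [h2] at h3
    exact Complex.hasSum_ofReal.1 (by simpa using h3)
  refine ⟨fun i => D (basis H i), hv, fun A => ?_⟩
  rw [← (hasSum_vecExpect_rankOne (basis H) hv A).tsum_eq, State.expect, trace]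
  refine tsum_congr fun j => ?_
  rw [mul_apply_eq_comp, hρ, ← hD,
    ← ((basis H).hasSum_inner_mul_inner (D (basis H j)) (D (A (basis H j)))).tsum_eq, vecExpect]
  refine tsum_congr fun i => ?_
  rw [rankOne_apply, inner_smul_right, hD, hD]

/-- A positive normalized functional which is normal (here: additive on the resolution of the
identity given by the fixed basis) is the expectation functional of a state. -/
theorem exists_state_of_normal (Φ : (H →L[ℂ] H) → ℂ) (hadd : ∀ A B, Φ (A + B) = Φ A + Φ B)
    (hsmul : ∀ (a : ℂ) A, Φ (a • A) = a * Φ A) (hle : ∀ A, ‖Φ A‖ ≤ ‖A‖)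
    (hpos : ∀ x, 0 ≤ Φ (rankOne ℂ x x)) (hone : Φ 1 = 1)
    (hsum : ∀ A : H →L[ℂ] H,
      HasSum (fun j => Φ (rankOne ℂ (A (basis H j)) (basis H j))) (Φ A)) :
    ∃ σ : State H, ∀ A, σ.expect A = Φ A := by
  -- The form `(x, y) ↦ Φ(|y⟩⟨x|)` is bounded by `1` because `|y⟩⟨x|` has norm `‖x‖ ‖y‖`; Riesz
  -- represents it as `⟨x, T y⟩`.
  let B : H →L⋆[ℂ] H →L[ℂ] ℂ := LinearMap.mkContinuous₂
    (LinearMap.mk₂'ₛₗ (starRingEnd ℂ) (RingHom.id ℂ) (fun x y => Φ (rankOne ℂ y x))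
      (fun x x' y => by simp [hadd])
      (fun a x y => by simp [hsmul])
      (fun x y y' => by simp [hadd])
      (fun a x y => by simp [hsmul]))
    1 (fun x y => (hle _).trans_eq (by
      rw [InnerProductSpace.norm_rankOne, one_mul, mul_comm]))
  let T := (InnerProductSpace.continuousLinearMapOfBilin B).adjoint
  have hT : ∀ x y, ⟪x, T y⟫_ℂ = Φ (rankOne ℂ y x) := fun x y => by
    rw [ContinuousLinearMap.adjoint_inner_right,
      InnerProductSpace.continuousLinearMapOfBilin_apply]
    rfl
  -- The `j`-th diagonal entry of `T A` is `Φ(|A bⱼ⟩⟨bⱼ|)`, so the trace formula is exactly the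
  -- normality hypothesis.
  have htr : ∀ A : H →L[ℂ] H, trace (T * A) = Φ A := fun A => by
    simp only [trace, mul_apply_eq_comp, hT]
    exact (hsum A).tsum_eq
  refine ⟨⟨T, ?_, ?_⟩, htr⟩
  · rw [ContinuousLinearMap.isPositive_iff_complex]
    intro x
    have h := hpos x
    rw [← hT, Complex.nonneg_iff] at h
    rw [← inner_conj_symm]
    generalize ⟪x, T x⟫_ℂ = z at h ⊢
    exact ⟨by apply Complex.ext <;> simp [← h.2], by simpa using h.1⟩
  · have := htr 1
    rwa [mul_one, hone] at this

/-- Applied to the vectors `ξ ⊗ vᵢ`, this yields `|ξ⟩⟨ξ| ⊗ ρ` without forming a tensor product of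
operators. -/
theorem exists_state_of_vecExpect {ι : Type*} {w : ι → H} (hw : HasSum (fun i => ‖w i‖ ^ 2) 1) :
    ∃ σ : State H, ∀ A, σ.expect A = vecExpect w A :=
  exists_state_of_normal _ (vecExpect_add hw) vecExpect_smul
    (fun A => by simpa using norm_vecExpect_le hw A) vecExpect_rankOne_self_nonneg
    (by simpa using vecExpect_one hw) (hasSum_vecExpect_rankOne _ hw)

theorem State.tendsto_nhds_iff {α : Type*} {l : Filter α} {σ : α → State H} {ρ : State H} :
    Tendsto σ l (𝓝 ρ) ↔ ∀ A, Tendsto (fun a => (σ a).expect A) l (𝓝 (ρ.expect A)) := by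
  rw [(Topology.IsInducing.mk rfl :
    Topology.IsInducing fun (ρ : State H) (A : H →L[ℂ] H) => ρ.expect A).tendsto_nhds_iff,
    tendsto_pi_nhds]
  rfl

end State

/-! ### Averaging a state over the group -/

section Average

variable {G K : Type*} [Group G] [TopologicalSpace G]
  [NormedAddCommGroup K] [InnerProductSpace ℂ K] [CompleteSpace K]

/-- Projectivity gives only `U(1) = c U(1)²`. Cancelling the unitary leaves `c U(1) = 1`, so `U(1)`
is a phase, and a phase drops out of the conjugation. -/
theorem ProjRep.act_one (U : ProjRep G K) (A : K →L[ℂ] K) : U.act 1 A = A := by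
  obtain ⟨c, hc, h⟩ := U.map_mul 1 1
  have hu : (U.toFun 1 : K →L[ℂ] K) * star (U.toFun 1 : K →L[ℂ] K) = 1 :=
    Unitary.mul_star_self_of_mem (U.toFun 1).2
  have h1 : c • (U.toFun 1 : K →L[ℂ] K) = 1 := by
    rw [mul_one] at h
    have := congrArg (· * star (U.toFun 1 : K →L[ℂ] K)) h
    simpa [smul_mul_assoc, mul_assoc, hu] using this.symm
  have hc0 : c ≠ 0 := fun h0 => by simp [h0] at hc
  have h2 : (U.toFun 1 : K →L[ℂ] K) = c⁻¹ • 1 := by rw [← h1, inv_smul_smul₀ hc0]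
  rw [h2] at hu
  rw [ProjRep.act, h2]
  simp only [star_smul, star_one, smul_mul_assoc, mul_smul_comm, one_mul, mul_one] at hu ⊢
  rw [smul_smul] at hu ⊢
  calc _ = A * ((star c⁻¹ * c⁻¹) • 1) := by rw [mul_smul_comm, mul_one]
    _ = A := by rw [hu, mul_one]

theorem ProjRep.inner_act (U : ProjRep G K) (g : G) (A : K →L[ℂ] K) (x : K) :
    ⟪x, U.act g A x⟫_ℂ = ⟪star (U.toFun g : K →L[ℂ] K) x,
      A (star (U.toFun g : K →L[ℂ] K) x)⟫_ℂ := by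
  rw [ContinuousLinearMap.star_eq_adjoint, ContinuousLinearMap.adjoint_inner_left]
  rfl

theorem ProjRep.norm_star_apply (U : ProjRep G K) (g : G) (x : K) :
    ‖star (U.toFun g : K →L[ℂ] K) x‖ = ‖x‖ := by
  have h := U.inner_act g 1 x
  have hu : U.act g 1 = 1 := by
    rw [ProjRep.act, mul_one]
    exact Unitary.mul_star_self_of_mem (U.toFun g).2
  rw [hu, one_apply_eq_self, one_apply_eq_self, inner_self_eq_norm_sq_to_K,
    inner_self_eq_norm_sq_to_K] at h
  have h' : ‖x‖ ^ 2 = ‖star (U.toFun g : K →L[ℂ] K) x‖ ^ 2 := by exact_mod_cast h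
  exact ((sq_eq_sq₀ (norm_nonneg _) (norm_nonneg _)).1 h').symm

variable {ι : Type*} {v : ι → K}

/-- Passing to the Schrödinger picture moves the action onto the vectors. Their norms are preserved,
so every fact about `vecExpect` holds uniformly in `g`. -/
theorem vecExpect_act (U : ProjRep G K) (g : G) (A : K →L[ℂ] K) :
    vecExpect v (U.act g A) = vecExpect (fun i => star (U.toFun g : K →L[ℂ] K) (v i)) A :=
  tsum_congr fun i => U.inner_act g A (v i)

theorem hasSum_norm_star_apply (U : ProjRep G K) (g : G) {c : ℝ}
    (hv : HasSum (fun i => ‖v i‖ ^ 2) c) :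
    HasSum (fun i => ‖star (U.toFun g : K →L[ℂ] K) (v i)‖ ^ 2) c := by
  simpa only [U.norm_star_apply] using hv

theorem norm_vecExpect_act_le (U : ProjRep G K) (hv : HasSum (fun i => ‖v i‖ ^ 2) 1)
    (g : G) (A : K →L[ℂ] K) : ‖vecExpect v (U.act g A)‖ ≤ ‖A‖ := by
  rw [vecExpect_act]
  simpa using norm_vecExpect_le (hasSum_norm_star_apply U g hv) A

/-- Each term is continuous in `g` by strong continuity of the action, and `‖A‖ ‖vᵢ‖²` is a summable
majorant independent of `g`. -/
theorem continuous_vecExpect_act (U : ProjRep G K) {c : ℝ} (hv : HasSum (fun i => ‖v i‖ ^ 2) c)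
    (A : K →L[ℂ] K) : Continuous fun g => vecExpect v (U.act g A) :=
  continuous_tsum (fun i => continuous_const.inner (U.continuous_conj A (v i)))
    (hv.summable.mul_left ‖A‖) fun i g => (norm_inner_apply_self_le _ _).trans
      (by gcongr; exact U.norm_act_le g A)

variable [MeasurableSpace G] [BorelSpace G]

theorem integrable_vecExpect_act (U : ProjRep G K) (hv : HasSum (fun i => ‖v i‖ ^ 2) 1)
    (A : K →L[ℂ] K) (μ : Measure G) [IsFiniteMeasure μ] :
    Integrable (fun g => vecExpect v (U.act g A)) μ :=
  .of_bound (continuous_vecExpect_act U hv A).aestronglyMeasurable ‖A‖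
    (ae_of_all _ fun g => norm_vecExpect_act_le U hv g A)

open InnerProductSpace (rankOne) in
/-- The average of a state over the group, as a state. -/
theorem exists_state_average [TopologicalSpace.SeparableSpace K] (U : ProjRep G K)
    (hv : HasSum (fun i => ‖v i‖ ^ 2) 1) (μ : Measure G) [IsProbabilityMeasure μ] :
    ∃ σ : State K, ∀ A, σ.expect A = ∫ g, vecExpect v (U.act g A) ∂μ := by
  have hint := fun A => integrable_vecExpect_act U hv A μ
  -- Separability enters here: the exchange of sum and integral below needs a countable basis.
  have : Countable (basisSet K) := (basis K).orthonormal.countable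
  refine exists_state_of_normal _ (fun A B => ?_) (fun a A => ?_) (fun A => ?_) (fun x => ?_) ?_
    fun A => ?_
  · rw [← integral_add (hint A) (hint B)]
    refine integral_congr_ae (ae_of_all _ fun g => ?_)
    simp only [vecExpect_act]
    exact vecExpect_add (hasSum_norm_star_apply U g hv) A B
  · rw [← integral_const_mul]
    refine integral_congr_ae (ae_of_all _ fun g => ?_)
    simp only [vecExpect_act]
    exact vecExpect_smul a A
  · simpa using norm_integral_le_of_norm_le_const (μ := μ)
      (ae_of_all _ fun g => norm_vecExpect_act_le U hv g A)
  · refine integral_nonneg fun g => ?_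
    simp only [vecExpect_act]
    exact vecExpect_rankOne_self_nonneg x
  · have h : ∀ g, vecExpect v (U.act g 1) = 1 := fun g => by
      rw [vecExpect_act]
      simpa using vecExpect_one (hasSum_norm_star_apply U g hv)
    simp [h]
  · have hs : ∀ g (s : Finset (basisSet K)), ∑ j ∈ s,
        ‖vecExpect v (U.act g (rankOne ℂ (A (basis K j)) (basis K j)))‖ ≤ ‖A‖ := fun g s => by
      simp only [vecExpect_act]
      simpa using sum_norm_vecExpect_rankOne_le (basis K).orthonormal
        (hasSum_norm_star_apply U g hv) A s
    -- Normality of the average: the partial sums of `∫ ‖F j‖` stay below `‖A‖` since `hs` is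
    -- uniform in `g`.
    have h := hasSum_integral_of_summable_integral_norm (μ := μ)
      (F := fun j g => vecExpect v (U.act g (rankOne ℂ (A (basis K j)) (basis K j))))
      (fun j => hint _) (summable_of_sum_le (c := ‖A‖)
        (fun j => integral_nonneg fun g => norm_nonneg _) fun s => by
          rw [← integral_finsetSum _ fun j _ => (hint _).norm]
          refine (integral_mono (integrable_finsetSum _ fun j _ => (hint _).norm)
            (integrable_const ‖A‖) fun g => hs g s).trans_eq (by simp))
    have heq : ∀ g, ∑' j, vecExpect v (U.act g (rankOne ℂ (A (basis K j)) (basis K j))) =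
        vecExpect v (U.act g A) := fun g => by
      simp only [vecExpect_act]
      exact (hasSum_vecExpect_rankOne (basis K) (hasSum_norm_star_apply U g hv) A).tsum_eq
    simpa only [heq] using h

/-- Splits the average into single vectors, the form in which `inner_yen` evaluates `¥(A)` on
product vectors. -/
theorem integral_vecExpect_act [Countable ι] (U : ProjRep G K)
    (hv : HasSum (fun i => ‖v i‖ ^ 2) 1) (A : K →L[ℂ] K) (μ : Measure G) [IsProbabilityMeasure μ] :
    ∫ g, vecExpect v (U.act g A) ∂μ = ∑' i, ∫ g, ⟪v i, U.act g A (v i)⟫_ℂ ∂μ := by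
  have hle : ∀ i g, ‖⟪v i, U.act g A (v i)⟫_ℂ‖ ≤ ‖A‖ * ‖v i‖ ^ 2 := fun i g =>
    (norm_inner_apply_self_le _ _).trans (by gcongr; exact U.norm_act_le g A)
  have hint : ∀ i, Integrable (fun g => ⟪v i, U.act g A (v i)⟫_ℂ) μ := fun i =>
    .of_bound (continuous_const.inner (U.continuous_conj A (v i))).aestronglyMeasurable _
      (ae_of_all _ (hle i))
  refine (hasSum_integral_of_summable_integral_norm hint ?_).tsum_eq.symm
  refine .of_nonneg_of_le (fun i => integral_nonneg fun g => norm_nonneg _) (fun i => ?_)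
    (hv.summable.mul_left ‖A‖)
  refine (integral_mono (hint i).norm (integrable_const _) (hle i)).trans_eq (by simp)

end Average

/-! ### Localizing the frame at the identity -/

section Localization

variable {G H : Type*} [Group G] [TopologicalSpace G] [IsTopologicalGroup G]
  [SecondCountableTopology G] [MeasurableSpace G] [BorelSpace G]
  [NormedAddCommGroup H] [InnerProductSpace ℂ H] [CompleteSpace H]

theorem POVM.isProbabilityMeasure_measure {X : Type*} [MeasurableSpace X] (E : POVM X H) {x : H}
    (hx : ‖x‖ = 1) : IsProbabilityMeasure (E.measure x) := by
  refine ⟨?_⟩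
  rw [E.measure_apply x MeasurableSet.univ, E.map_univ]
  simp [hx]

/-- If `E(V)` vanished, covariance would make every translate `gV` null. Countably many translates
cover the second countable group, so a probability measure would have total mass zero. -/
theorem PrincipalFrame.toFun_ne_zero [Nontrivial H] (R : PrincipalFrame G H) {V : Set G}
    (hV : IsOpen V) (h1 : (1 : G) ∈ V) : R.povm.toFun V ≠ 0 := by
  intro h0
  obtain ⟨x, hx⟩ := exists_norm_eq H zero_le_one
  have := R.povm.isProbabilityMeasure_measure hx
  obtain ⟨s, hs, hcov⟩ := TopologicalSpace.countable_cover_nhds (f := fun g : G => g • V)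
    fun g => by simpa using smul_mem_nhds_smul g (hV.mem_nhds h1)
  have hz : R.povm.measure x Set.univ = 0 := by
    rw [← hcov, measure_biUnion_null_iff hs]
    intro g _
    rw [R.povm.measure_apply x (hV.smul g).measurableSet, R.covariant g V hV.measurableSet, h0]
    simp [ProjRep.act]
  exact one_ne_zero (measure_univ.symm.trans hz)

/-- Averages of a bounded continuous function against probability measures that concentrate at
a point converge to its value there. -/
theorem tendsto_integral_of_concentrated {X : Type*} [TopologicalSpace X]
    [SecondCountableTopology X] [MeasurableSpace X] [BorelSpace X] (μ : ℕ → Measure X)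
    [∀ n, IsProbabilityMeasure (μ n)] {a : X}
    (hμ : ∀ V ∈ 𝓝 a, Tendsto (fun n => (μ n).real Vᶜ) atTop (𝓝 0))
    {f : X → ℂ} (hf : Continuous f) {C : ℝ} (hC : ∀ x, ‖f x‖ ≤ C) :
    Tendsto (fun n => ∫ x, f x ∂(μ n)) atTop (𝓝 (f a)) := by
  rw [Metric.tendsto_atTop]
  intro ε hε
  -- On `V` the error is below `ε / 2`; off `V` it is at most `2 * C`, and the mass there tends to
  -- zero.
  let V := f ⁻¹' Metric.ball (f a) (ε / 2)
  have hV : IsOpen V := Metric.isOpen_ball.preimage hf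
  have hVa : V ∈ 𝓝 a := hV.mem_nhds (Metric.mem_ball_self (by positivity))
  have hC0 : 0 ≤ C := (norm_nonneg _).trans (hC a)
  have hlim := (hμ V hVa).const_mul (2 * C)
  rw [mul_zero] at hlim
  obtain ⟨N, hN⟩ := (hlim.eventually (gt_mem_nhds (half_pos hε))).exists_forall_of_atTop
  refine ⟨N, fun n hn => ?_⟩
  have hint : Integrable f (μ n) := .of_bound hf.aestronglyMeasurable C (ae_of_all _ hC)
  have hpt : ∀ x, ‖f x - f a‖ ≤ ε / 2 + Vᶜ.indicator (fun _ => 2 * C) x := by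
    intro x
    by_cases hx : x ∈ V
    · have : ‖f x - f a‖ < ε / 2 := by simpa [V, dist_eq_norm] using hx
      simpa [hx] using this.le
    · have := norm_sub_le (f x) (f a)
      simp only [Set.mem_compl_iff, hx, not_false_eq_true, Set.indicator_of_mem]
      linarith [hC x, hC a]
  calc dist (∫ x, f x ∂(μ n)) (f a) = ‖∫ x, (f x - f a) ∂(μ n)‖ := by
        rw [integral_sub hint (integrable_const _), dist_eq_norm]
        simp
    _ ≤ ∫ x, (ε / 2 + Vᶜ.indicator (fun _ => 2 * C) x) ∂(μ n) :=
        norm_integral_le_of_norm_le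
          ((integrable_const _).add ((integrable_const _).indicator hV.measurableSet.compl))
          (ae_of_all _ hpt)
    _ = ε / 2 + 2 * C * (μ n).real Vᶜ := by
        rw [integral_add (integrable_const _)
          ((integrable_const _).indicator hV.measurableSet.compl),
          integral_indicator_const _ hV.measurableSet.compl]
        simp [mul_comm]
    _ < ε := by linarith [hN n hn]

theorem PrincipalFrame.exists_localizing_sequence [Nontrivial H] (R : PrincipalFrame G H)
    (hR : R.povm.Localizable) : ∃ ξ : ℕ → H, (∀ n, ‖ξ n‖ = 1) ∧
      ∀ V ∈ 𝓝 (1 : G), Tendsto (fun n => (R.povm.measure (ξ n)).real Vᶜ) atTop (𝓝 0) := by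
  obtain ⟨W, hW, hbasis⟩ := (nhds_basis_opens (1 : G)).exists_antitone_subbasis
  -- Localizability with `ε = 1/(n+1)` leaves mass less than `1/(n+1)` outside `W n`, hence outside
  -- any neighbourhood containing `W n`.
  have hex : ∀ n : ℕ, ∃ x : H, ‖x‖ = 1 ∧
      1 - 1 / ((n : ℝ) + 1) < (⟪x, R.povm.toFun (W n) x⟫_ℂ).re := fun n =>
    hR _ (hW n).2.measurableSet (R.toFun_ne_zero (hW n).2 (hW n).1) _ (by positivity)
  choose ξ hξ hlt using hex
  refine ⟨ξ, hξ, fun V hV => ?_⟩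
  obtain ⟨N, -, hN⟩ := hbasis.1.mem_iff.1 hV
  refine squeeze_zero' (.of_forall fun n => measureReal_nonneg) ?_
    tendsto_one_div_add_atTop_nhds_zero_nat
  filter_upwards [eventually_ge_atTop N] with n hn
  have := R.povm.isProbabilityMeasure_measure (hξ n)
  have hm := (hW n).2.measurableSet
  have hsub : Vᶜ ⊆ (W n)ᶜ := Set.compl_subset_compl.2 ((hbasis.2 hn).trans hN)
  refine (measureReal_mono hsub).trans ?_
  have h := hlt n
  rw [R.povm.inner_eq_measure hm, Complex.ofReal_re] at h
  rw [probReal_compl_eq_one_sub hm]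
  linarith

end Localization

/-! ### Relative states of product states -/

section RelativeStates

variable {G H K : Type*} [Group G] [TopologicalSpace G] [IsTopologicalGroup G]
  [SecondCountableTopology G] [T2Space G] [MeasurableSpace G] [BorelSpace G]
  [NormedAddCommGroup H] [InnerProductSpace ℂ H] [CompleteSpace H]
  [NormedAddCommGroup K] [InnerProductSpace ℂ K] [CompleteSpace K]
  [TopologicalSpace.SeparableSpace K]

/-- For a unit vector `ξ` of the frame, the average of a state `ρ` against `⟨ξ, E(·) ξ⟩` is the
relative state of the product state `|ξ⟩⟨ξ| ⊗ ρ`. -/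
theorem PrincipalFrame.exists_mem_relativeStates (R : PrincipalFrame G H) (U : ProjRep G K)
    {ξ : H} (hξ : ‖ξ‖ = 1) {ι : Type*} [Countable ι] {v : ι → K}
    (hv : HasSum (fun i => ‖v i‖ ^ 2) 1) :
    ∃ σ ∈ R.relativeStates U,
      ∀ A, σ.expect A = ∫ g, vecExpect v (U.act g A) ∂(R.povm.measure ξ) := by
  have := R.povm.isProbabilityMeasure_measure hξ
  obtain ⟨σ, hσ⟩ := exists_state_average U hv (R.povm.measure ξ)
  obtain ⟨Ω, hΩ⟩ := exists_state_of_vecExpect (w := fun i => htmul ξ (v i)) (by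
    simpa [htmul, hξ] using hv)
  refine ⟨σ, ⟨Ω, fun A => ?_⟩, hσ⟩
  rw [hσ, hΩ, integral_vecExpect_act U hv]
  -- Only diagonal elements at product vectors occur, so the defining property of `¥(A)` suffices.
  exact tsum_congr fun i => (R.inner_yen U A ξ (v i)).symm

end RelativeStates

end QRF

/-! ### The density theorem -/

theorem mainTheorem11 {G HR HS : Type*}
    [Group G] [TopologicalSpace G] [IsTopologicalGroup G] [LocallyCompactSpace G]
    [SecondCountableTopology G] [T2Space G] [MeasurableSpace G] [BorelSpace G]
    [NormedAddCommGroup HR] [InnerProductSpace ℂ HR] [CompleteSpace HR]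
    [TopologicalSpace.SeparableSpace HR] [Nontrivial HR]
    [NormedAddCommGroup HS] [InnerProductSpace ℂ HS] [CompleteSpace HS]
    [TopologicalSpace.SeparableSpace HS]
    (R : QRF.PrincipalFrame G HR) (hR : R.povm.Localizable) (U : QRF.ProjRep G HS) :
    Dense (R.relativeStates U) ∧
      ∀ ρ : QRF.State HS, ∃ σ : ℕ → QRF.State HS,
        (∀ n, σ n ∈ R.relativeStates U) ∧ Tendsto σ atTop (𝓝 ρ) := by
  have key : ∀ ρ : QRF.State HS, ∃ σ : ℕ → QRF.State HS,
      (∀ n, σ n ∈ R.relativeStates U) ∧ Tendsto σ atTop (𝓝 ρ) := by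
    intro ρ
    have : Countable (QRF.basisSet HS) := (QRF.basis HS).orthonormal.countable
    obtain ⟨v, hv, hρ⟩ := ρ.exists_vecExpect
    obtain ⟨ξ, hξ, hloc⟩ := R.exists_localizing_sequence hR
    have := fun n => R.povm.isProbabilityMeasure_measure (hξ n)
    choose σ hmem hσ using fun n => R.exists_mem_relativeStates U (hξ n) hv
    refine ⟨σ, hmem, QRF.State.tendsto_nhds_iff.2 fun A => ?_⟩
    -- `ξ` is chosen independently of `A`, so a single sequence of relative states works for all
    -- observables.
    have h := QRF.tendsto_integral_of_concentrated _ hloc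
      (QRF.continuous_vecExpect_act U hv A) fun g => QRF.norm_vecExpect_act_le U hv g A
    rw [U.act_one, ← hρ] at h
    simpa only [hσ] using h
  refine ⟨fun ρ => ?_, key⟩
  obtain ⟨σ, hmem, hσ⟩ := key ρ
  exact mem_closure_of_tendsto hσ (.of_forall hmem)
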